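/- Let $n\ge 0$ and let $f$ be a symmetric partial Boolean function on $n$ bits: $f$ is a $\{0,1\}$-valued function on a domain $D\subseteq\{0,1\}^n$ ($D=\{0,1\}^n$ allowed) such that $x\in D$ and $|y|=|x|$ imply $y\in D$ and $f(y)=f(x)$, where $|x|$ is the Hamming weight. Let $Q_E(f)$ be the exact quantum query complexity of $f$, i.e. the least $t$ for which there are an $m\ge 1$, a unit vector $|\psi_s\rangle$ in the Hilbert space with orthonormal basis $|i,j\rangle$ ($0\le i\le n$, $1\le j\le m$), unitaries $U_0,\dots,U_t$ and a measurement $\{M_0,M_1\}$ (with $M_0^\dagger M_0+M_1^\dagger M_1=I$), all independent of the input, such that $\|M_{f(x)}U_tO_xU_{t-1}\cdots U_1O_xU_0|\psi_s\rangle\|^2=1$ for all $x\in D$; here $O_x|0,j\rangle=|0,j\rangle$ and $O_x|i,j\rangle=(-1)^{x_i}|i,j\rangle$ for $i\ge 1$. Two partial functions on $n$ bits are isomorphic if they are equal up to negations and permutations of the input variables and negation of the output. Let $f^{(1)}_{n,k}$ be the partial function that is $0$ on weight $0$, $1$ on weight $k$ and undefined elsewhere, and $f^{(3)}_{n,l}$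 the one that is $0$ on weights $0$ and $n$, $1$ on weight $l$ and undefined elsewhere. Then: 1. If $n\ge 2$ is even, then $Q_E(f)=1$ if and only if $f$ is isomorphic to $f^{(1)}_{n,k}$ for some $k$ with $n/2\le k\le n$, or to the Deutsch–Jozsa function $f^{(3)}_{n,n/2}$. 2. If $n$ is odd, then $Q_E(f)=1$ if and only if $f$ is isomorphic to $f^{(1)}_{n,k}$ for some $k$ with $\lceil n/2\rceil\le k\le n$. 3. For every $n$: $Q_E(f)=1$ if and only if $f$ is nonconstant on its domain (takes both values $0$ and $1$) and can be computed by the Deutsch–Jozsa algorithm after padding, which means: there are a partial function $g$ isomorphic to $f$, an integer $p\ge 0$ with $N=n+p$ even and positive, and a string $w\in\{0,1\}^p$ such that, for every $x$ in the domain of $g$, the Deutsch–Jozsa algorithm on $N$ bits run on the concatenation $xw$ outputs $g(x)$ with probability $1$. The same equivalence holds if $w$ is required to be the all-zeros string $0^p$. Here the Deutsch–Jozsa algorithm on $N$ bits prepares $|\psi\rangle=\frac1{\sqrt N}\sum_{i=1}^N|i\rangle$, makes one query, and measures with $M_0=|\psi\rangle\langle\psi|$, $M_1=I-|\psi\rangle\langle\psi|$,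 returning the index of the outcome. -/

import Mathlib

noncomputable section

namespace QuantumQuery

/-! ### Partial Boolean functions -/

/-- A partial Boolean function on `n`-bit strings: `f x = none` means that `f` is undefined
at `x`, so the domain of definition is `{x | f x ≠ none}`. -/
abbrev PartialBoolFun (n : ℕ) := (Fin n → Bool) → Option Bool

/-- The Hamming weight `|x|`. -/
def weight {n : ℕ} (x : Fin n → Bool) : ℕ :=
  (Finset.univ.filter fun i => x i = true).card

/-- `f` is symmetric: if `x` is in the domain and `|y| = |x|`, then `y` is in the domain
and `f y = f x`. -/
def IsSymmetric {n : ℕ} (f : PartialBoolFun n) : Prop :=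
  ∀ x y : Fin n → Bool, f x ≠ none → weight x = weight y → f y ≠ none ∧ f x = f y

/-- `f` takes both values `0` and `1` on its domain. -/
def IsNonconstant {n : ℕ} (f : PartialBoolFun n) : Prop :=
  (∃ x, f x = some false) ∧ ∃ y, f y = some true

/-- `f` and `g` are equal up to negations and permutations of the input variables and
negation of the output: `s` marks the negated variables, `π` permutes the variables and `c` says
whether the output is negated. -/
def Isomorphic {n : ℕ} (f g : PartialBoolFun n) : Prop :=
  ∃ (π : Equiv.Perm (Fin n)) (s : Fin n → Bool) (c : Bool),
    ∀ x, g x = (f fun i => xor (x (π i)) (s i)).map (xor c)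

/-- `f⁽¹⁾_{n,k}`: value `0` on weight `0`, value `1` on weight `k`, undefined elsewhere
(meant for `1 ≤ k ≤ n`). -/
def f₁ (n k : ℕ) : PartialBoolFun n := fun x =>
  if weight x = 0 then some false else if weight x = k then some true else none

/-- `f⁽³⁾_{n,l}`: value `0` on weights `0` and `n`, value `1` on weight `l`, undefined elsewhere
(meant for `1 ≤ l < n`). For `l = n / 2`, `n` even, it is the Deutsch–Jozsa function. -/
def f₃ (n l : ℕ) : PartialBoolFun n := fun x =>
  if weight x = 0 ∨ weight x = n then some false
  else if weight x = l then some true else none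

/-! ### Quantum query algorithms -/

/-- The Hilbert space with orthonormal basis `|i, j⟩`, `0 ≤ i ≤ n`, `j` one of `m` values. -/
abbrev QSpace (n m : ℕ) := EuclideanSpace ℂ (Fin (n + 1) × Fin m)

/-- The phase `1` for `i = 0` and `(-1)^{x_i}` for `1 ≤ i ≤ n`
(the bit `x_{i+1}` is `x i` with `i : Fin n`). -/
def phase {n : ℕ} (x : Fin n → Bool) : Fin (n + 1) → ℂ :=
  Fin.cases 1 fun i => if x i = true then -1 else 1

/-- The query `O_x`, with `O_x |i, j⟩ = phase x i • |i, j⟩`. -/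
def oracle {n : ℕ} (m : ℕ) (x : Fin n → Bool) : QSpace n m →ₗ[ℂ] QSpace n m where
  toFun ψ := WithLp.toLp 2 fun p => phase x p.1 * ψ p
  map_add' ψ φ := by
    ext p
    simp [mul_add]
  map_smul' c ψ := by
    ext p
    simp [mul_left_comm]

/-- A quantum algorithm making `t` queries to an `n`-bit input: a finite workspace, a fixed
starting unit vector, unitary operators `U_0, …, U_t` and a two-outcome measurement
`{M_0, M_1}`. -/
structure QueryAlgorithm (n t : ℕ) where
  /-- the size of the workspace -/
  m : ℕ
  start : QSpace n m
  norm_start : ‖start‖ = 1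
  U : Fin (t + 1) → (QSpace n m ≃ₗᵢ[ℂ] QSpace n m)
  M : Bool → (QSpace n m →L[ℂ] QSpace n m)
  complete : (M false).adjoint ∘L M false + (M true).adjoint ∘L M true =
    ContinuousLinearMap.id ℂ (QSpace n m)

namespace QueryAlgorithm

variable {n t : ℕ}

/-- The state `U_k O_x U_{k-1} ⋯ U_1 O_x U_0 |ψ_s⟩`. -/
def stateAfter (A : QueryAlgorithm n t) (x : Fin n → Bool) (k : Fin (t + 1)) : QSpace n A.m :=
  Fin.induction (motive := fun _ => QSpace n A.m) (A.U 0 A.start)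
    (fun k ψ => A.U k.succ (oracle A.m x ψ)) k

/-- The final state `U_t O_x U_{t-1} ⋯ U_1 O_x U_0 |ψ_s⟩`. -/
def finalState (A : QueryAlgorithm n t) (x : Fin n → Bool) : QSpace n A.m :=
  A.stateAfter x (Fin.last t)

/-- The probability that the algorithm outputs `b` on input `x`. -/
def prob (A : QueryAlgorithm n t) (x : Fin n → Bool) (b : Bool) : ℝ :=
  ‖A.M b (A.finalState x)‖ ^ 2

/-- The algorithm computes `f` exactly: on every `x` in the domain of `f` it outputs `f x`
with probability `1`. -/
def ComputesExactly (A : QueryAlgorithm n t) (f : PartialBoolFun n) : Prop :=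
  ∀ x b, f x = some b → A.prob x b = 1

end QueryAlgorithm

/-- The exact quantum query complexity `Q_E(f)`: the least number of queries of a quantum
algorithm that computes `f` exactly. -/
def QE {n : ℕ} (f : PartialBoolFun n) : ℕ :=
  sInf {t | ∃ A : QueryAlgorithm n t, A.ComputesExactly f}

/-! ### The Deutsch–Jozsa algorithm -/

/-- The uniform superposition of `|1⟩, …, |N⟩` (with one-dimensional workspace). -/
def uniformState (N : ℕ) : QSpace N 1 :=
  WithLp.toLp 2 fun p => if p.1 = 0 then 0 else ((1 / √(N : ℝ) : ℝ) : ℂ)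

theorem norm_uniformState {N : ℕ} (hN : 0 < N) : ‖uniformState N‖ = 1 := by
  have hN' : (0 : ℝ) < N := by exact_mod_cast hN
  rw [EuclideanSpace.norm_eq, Real.sqrt_eq_one, Fintype.sum_prod_type, Fin.sum_univ_succ]
  simp [uniformState, hN'.ne']

theorem projective_complete {N m : ℕ} (K : Submodule ℂ (QSpace N m)) :
    K.starProjection.adjoint ∘L K.starProjection +
      (ContinuousLinearMap.id ℂ (QSpace N m) - K.starProjection).adjoint ∘L
        (ContinuousLinearMap.id ℂ (QSpace N m) - K.starProjection) =
    ContinuousLinearMap.id ℂ (QSpace N m) := by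
  have h := isStarProjection_starProjection (U := K)
  have h1 := h.one_sub
  have e := h.isSelfAdjoint.star_eq
  have e1 := h1.isSelfAdjoint.star_eq
  have i := h.isIdempotentElem.eq
  have i1 := h1.isIdempotentElem.eq
  change star K.starProjection * K.starProjection +
    star (1 - K.starProjection) * (1 - K.starProjection) = 1
  rw [e, e1, i, i1]
  abel

/-- The Deutsch–Jozsa algorithm on `N ≥ 1` bits: prepare the uniform superposition `|ψ⟩` of
`|1⟩, …, |N⟩`, make one query, and measure whether the state is still `|ψ⟩`, i.e. measure with
`M_0 = |ψ⟩⟨ψ|` and `M_1 = 1 - |ψ⟩⟨ψ|`; the output is `0` if it is, and `1` if not. -/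
def deutschJozsa (N : ℕ) (hN : 0 < N) : QueryAlgorithm N 1 where
  m := 1
  start := uniformState N
  norm_start := norm_uniformState hN
  U _ := LinearIsometryEquiv.refl ℂ _
  M b := bif b then ContinuousLinearMap.id ℂ _ - (ℂ ∙ uniformState N).starProjection
    else (ℂ ∙ uniformState N).starProjection
  complete := projective_complete _

/-- The Deutsch–Jozsa algorithm, run on the input `x` followed by the fixed string `w`
(the padded length being even and positive), outputs `g x` with certainty for every `x` in the
domain of `g`. -/
def DJComputesPadded {n p : ℕ} (g : PartialBoolFun n) (w : Fin p → Bool) : Prop :=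
  Even (n + p) ∧ ∃ hN : 0 < n + p,
    ∀ x b, g x = some b → (deutschJozsa (n + p) hN).prob (Fin.append x w) b = 1

/-- Up to isomorphism, `f` is computed by the Deutsch–Jozsa algorithm after its input is padded
with some fixed string. -/
def SolvableByDJ {n : ℕ} (f : PartialBoolFun n) : Prop :=
  ∃ g, Isomorphic f g ∧ ∃ (p : ℕ) (w : Fin p → Bool), DJComputesPadded g w

/-- Up to isomorphism, `f` is computed by the Deutsch–Jozsa algorithm after its input is padded
with some number of zeros. -/
def SolvableByDJZeros {n : ℕ} (f : PartialBoolFun n) : Prop :=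
  ∃ g, Isomorphic f g ∧ ∃ p : ℕ, DJComputesPadded g (fun _ : Fin p => false)

end QuantumQuery

end

/-! For symmetric nonconstant `f`, one exact query suffices iff `IsEquidistant f` holds
(`QE_eq_one_iff`). If `φ` is the state before the query, exactness makes `O_x φ` and `O_y φ`
orthogonal whenever `f x = 0` and `f y = 1`. Their inner product is `P₀ + ∑ pᵢ (±1)`, with the sign
recording whether `xᵢ = yᵢ`. By symmetry this also vanishes for all cyclic shifts of the pair;
averaging gives `n = 2 P · dist(x, y)` with `P = ∑ pᵢ ≤ 1`, so the distance is constant and at least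
`n / 2`. Conversely, weights `pᵢ = 1 / (2d)` make all these inner products zero.

Equidistance is rigid: if neither `x` nor `y` were constant strings, permuting `y` would change its
distance to `x` (`IsEquidistant.eq_const_or_eq_const`). So one value occurs only on constant
strings, and up to negations `f` is `f₁ n k` or the Deutsch–Jozsa function (`eq_f₁_or_eq_f₃`). Zero
padding makes weight `k` balanced, so both are solved by Deutsch–Jozsa. In the other direction, that
algorithm on padded inputs forces equidistance, since a common padding does not change distances. -/

namespace QuantumQuery

open scoped InnerProductSpace

variable {n : ℕ}

/-- All inputs with value `0` have the same distance, at least `n / 2`, to all inputs with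
value `1`. -/
def IsEquidistant (f : PartialBoolFun n) : Prop :=
  ∃ d, n ≤ 2 * d ∧ ∀ x y, f x = some false → f y = some true → hammingDist x y = d

/-! ### Weights and distances -/

theorem weight_eq_hammingDist (x : Fin n → Bool) :
    weight x = hammingDist (fun _ => false) x := by
  simp [weight, hammingDist]

theorem weight_comp_perm (x : Fin n → Bool) (σ : Equiv.Perm (Fin n)) :
    weight (fun i => x (σ i)) = weight x := by
  simp only [weight, Finset.card_filter]
  exact Equiv.sum_comp σ fun i => if x i = true then 1 else 0

theorem weight_le (x : Fin n → Bool) : weight x ≤ n := by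
  simpa [weight] using Finset.card_filter_le Finset.univ fun i => x i = true

theorem weight_not (x : Fin n → Bool) : weight (fun i => !x i) + weight x = n := by
  have h := Finset.card_filter_add_card_filter_not (s := Finset.univ) fun i => x i = true
  simp only [weight]
  simp at h ⊢
  omega

theorem weight_eq_zero_iff {x : Fin n → Bool} : weight x = 0 ↔ x = fun _ => false := by
  simp [weight, Finset.filter_eq_empty_iff, funext_iff]

theorem weight_eq_iff {x : Fin n → Bool} : weight x = n ↔ x = fun _ => true := by
  have h := weight_not x
  have h2 := weight_eq_zero_iff (x := fun i => !x i)
  simp [funext_iff] at h2 ⊢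
  rw [← h2]
  omega

theorem exists_weight_eq {k : ℕ} (hk : k ≤ n) : ∃ x : Fin n → Bool, weight x = k := by
  obtain ⟨s, -, hs⟩ := Finset.exists_subset_card_eq (s := (Finset.univ : Finset (Fin n)))
    (n := k) (by simpa using hk)
  exact ⟨fun i => decide (i ∈ s), by simpa [weight] using hs⟩

theorem hammingDist_comp_perm (x y : Fin n → Bool) (σ : Equiv.Perm (Fin n)) :
    hammingDist (fun i => x (σ i)) (fun i => y (σ i)) = hammingDist x y := by
  simp only [hammingDist, Finset.card_filter]
  exact Equiv.sum_comp σ fun i => if x i ≠ y i then 1 else 0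

theorem hammingDist_xor (x y s : Fin n → Bool) :
    hammingDist (fun i => xor (x i) (s i)) (fun i => xor (y i) (s i)) = hammingDist x y := by
  simp [hammingDist]

theorem hammingDist_append_right {p : ℕ} (x y : Fin n → Bool) (w : Fin p → Bool) :
    hammingDist (Fin.append x w) (Fin.append y w) = hammingDist x y := by
  simp [hammingDist, Finset.card_filter, Fin.sum_univ_add]

theorem weight_append_false {p : ℕ} (x : Fin n → Bool) :
    weight (Fin.append x fun _ : Fin p => false) = weight x := by
  simp only [weight, Finset.card_filter, Fin.sum_univ_add, Fin.append_left, Fin.append_right]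
  simp

theorem sum_sign_eq (x y : Fin n → Bool) :
    ∑ i, (if x i = y i then (1 : ℝ) else -1) = n - 2 * hammingDist x y := by
  have h : ∀ i, (if x i = y i then (1 : ℝ) else -1) = 1 - 2 * (if x i ≠ y i then 1 else 0) := by
    intro i
    split_ifs <;> simp_all
    norm_num
  simp only [h, Finset.sum_sub_distrib, ← Finset.mul_sum]
  simp only [hammingDist, Finset.card_filter]
  simp

/-- The average over the cyclic shifts of a weighted sum of signs. -/
theorem sum_shift_eq [NeZero n] (q : Fin n → ℝ) (x y : Fin n → Bool) :
    ∑ k, ∑ i, q i * (if x (i + k) = y (i + k) then 1 else -1) =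
      (∑ i, q i) * (n - 2 * hammingDist x y) := by
  rw [Finset.sum_comm, Finset.sum_mul]
  refine Finset.sum_congr rfl fun i _ => ?_
  rw [← Finset.mul_sum, ← sum_sign_eq]
  congr 1
  -- For fixed `i` the position `i + k` runs once over all positions, so the sum over `k` does not
  -- depend on `i`.
  exact Equiv.sum_comp (Equiv.addLeft i) fun k => if x k = y k then (1 : ℝ) else -1

/-! ### Isomorphism -/

/-- Permuting and negating inputs are Hamming isometries; negating the output exchanges `x` and `y`,
which the symmetry of the distance absorbs. -/
theorem Isomorphic.isEquidistant {f g : PartialBoolFun n} (h : Isomorphic f g)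
    (hf : IsEquidistant f) : IsEquidistant g := by
  obtain ⟨π, s, c, h⟩ := h
  obtain ⟨d, hd, hf⟩ := hf
  refine ⟨d, hd, fun x y hx hy => ?_⟩
  rw [h, Option.map_eq_some_iff] at hx hy
  obtain ⟨a, ha, hac⟩ := hx
  obtain ⟨b, hb, hbc⟩ := hy
  rw [← hammingDist_comp_perm x y π, ← hammingDist_xor _ _ s]
  cases c <;> simp at hac hbc <;> subst hac hbc
  · exact hf _ _ ha hb
  · rw [hammingDist_comm]
    exact hf _ _ hb ha

theorem Isomorphic.symm {f g : PartialBoolFun n} (h : Isomorphic f g) : Isomorphic g f := by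
  obtain ⟨π, s, c, h⟩ := h
  refine ⟨π.symm, fun i => s (π.symm i), c, fun x => ?_⟩
  rw [h]
  simp [Option.map_map, Function.comp_def]

theorem Isomorphic.isNonconstant {f g : PartialBoolFun n} (h : Isomorphic f g)
    (hf : IsNonconstant f) : IsNonconstant g := by
  obtain ⟨π, s, c, h⟩ := h.symm
  obtain ⟨⟨x, hx⟩, y, hy⟩ := hf
  rw [h, Option.map_eq_some_iff] at hx hy
  obtain ⟨a, ha, hac⟩ := hx
  obtain ⟨b, hb, hbc⟩ := hy
  cases c <;> simp at hac hbc <;> subst hac hbc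
  · exact ⟨⟨_, ha⟩, _, hb⟩
  · exact ⟨⟨_, hb⟩, _, ha⟩

/-! ### One-query algorithms and orthogonality -/

theorem oracle_apply {m : ℕ} (x : Fin n → Bool) (φ : QSpace n m) (p : Fin (n + 1) × Fin m) :
    oracle m x φ p = phase x p.1 * φ p := rfl

theorem inner_oracle {m : ℕ} (x y : Fin n → Bool) (φ : QSpace n m) :
    ⟪oracle m x φ, oracle m y φ⟫_ℂ =
      ((∑ j, ‖φ (0, j)‖ ^ 2 +
        ∑ i : Fin n, (∑ j, ‖φ (i.succ, j)‖ ^ 2) * (if x i = y i then 1 else -1) : ℝ) : ℂ) := by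
  have key : ∀ (u v : Bool) (z : ℂ), ((if v = true then (-1 : ℂ) else 1) * z) *
      (starRingEnd ℂ) ((if u = true then (-1 : ℂ) else 1) * z) =
      (‖z‖ : ℂ) ^ 2 * (if u = v then 1 else -1) := by
    intro u v z
    cases u <;> cases v <;> simp [Complex.mul_conj']
  rw [PiLp.inner_apply, Fintype.sum_prod_type, Fin.sum_univ_succ]
  simp only [oracle_apply, RCLike.inner_apply]
  simp only [phase, Fin.cases_zero, Fin.cases_succ, key, Finset.sum_mul]
  push_cast
  congr 1
  · simp [Complex.mul_conj']
  · refine Finset.sum_congr rfl fun i _ => Finset.sum_congr rfl fun j _ => ?_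
    split_ifs <;> simp

theorem norm_sq_eq_sum {m : ℕ} (φ : QSpace n m) :
    ‖φ‖ ^ 2 = ∑ j, ‖φ (0, j)‖ ^ 2 + ∑ i : Fin n, ∑ j, ‖φ (i.succ, j)‖ ^ 2 := by
  rw [EuclideanSpace.norm_sq_eq, Fintype.sum_prod_type, Fin.sum_univ_succ]

theorem norm_oracle {m : ℕ} (x : Fin n → Bool) (φ : QSpace n m) : ‖oracle m x φ‖ = ‖φ‖ := by
  have h' : ‖oracle m x φ‖ ^ 2 = ‖φ‖ ^ 2 := by
    rw [← inner_self_eq_norm_sq (𝕜 := ℂ), inner_oracle, norm_sq_eq_sum φ]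
    simp only [if_true, mul_one]
    exact Complex.ofReal_re _
  exact (sq_eq_sq₀ (norm_nonneg _) (norm_nonneg _)).1 h'

namespace QueryAlgorithm

variable {t : ℕ}

theorem inner_eq_add (A : QueryAlgorithm n t) (u v : QSpace n A.m) :
    ⟪u, v⟫_ℂ = ⟪A.M false u, A.M false v⟫_ℂ + ⟪A.M true u, A.M true v⟫_ℂ := by
  have h := congrArg (fun T : QSpace n A.m →L[ℂ] QSpace n A.m => ⟪u, T v⟫_ℂ) A.complete
  simp only [add_apply, ContinuousLinearMap.comp_apply, inner_add_right,
    ContinuousLinearMap.adjoint_inner_right, ContinuousLinearMap.id_apply] at h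
  exact h.symm

theorem norm_sq_eq_add (A : QueryAlgorithm n t) (u : QSpace n A.m) :
    ‖u‖ ^ 2 = ‖A.M false u‖ ^ 2 + ‖A.M true u‖ ^ 2 := by
  have h := A.inner_eq_add u u
  simp only [inner_self_eq_norm_sq_to_K] at h
  exact_mod_cast h

theorem norm_stateAfter (A : QueryAlgorithm n t) (x : Fin n → Bool) (k : Fin (t + 1)) :
    ‖A.stateAfter x k‖ = 1 := by
  induction k using Fin.induction with
  | zero => simp [stateAfter, A.norm_start]
  | succ k ih =>
    rw [stateAfter, Fin.induction_succ, LinearIsometryEquiv.norm_map, norm_oracle]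
    exact ih

theorem inner_finalState (A : QueryAlgorithm n t) {x y : Fin n → Bool}
    (hx : A.prob x false = 1) (hy : A.prob y true = 1) :
    ⟪A.finalState x, A.finalState y⟫_ℂ = 0 := by
  have h1 := A.norm_sq_eq_add (A.finalState x)
  have h2 := A.norm_sq_eq_add (A.finalState y)
  rw [finalState, norm_stateAfter, ← finalState] at h1 h2
  rw [prob] at hx hy
  have h3 : A.M true (A.finalState x) = 0 := by
    rw [← norm_eq_zero, ← sq_eq_zero_iff]; linarith
  have h4 : A.M false (A.finalState y) = 0 := by
    rw [← norm_eq_zero, ← sq_eq_zero_iff]; linarith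
  rw [A.inner_eq_add, h3, h4]
  simp

theorem sum_eq_zero_of_prob (A : QueryAlgorithm n 1) {x y : Fin n → Bool}
    (hx : A.prob x false = 1) (hy : A.prob y true = 1) :
    ∑ j, ‖A.U 0 A.start (0, j)‖ ^ 2 + ∑ i : Fin n, (∑ j, ‖A.U 0 A.start (i.succ, j)‖ ^ 2) *
      (if x i = y i then 1 else -1) = (0 : ℝ) := by
  have h := A.inner_finalState hx hy
  have e : ∀ z, A.finalState z = A.U 1 (oracle A.m z (A.U 0 A.start)) := fun z => rfl
  rw [e, e, LinearIsometryEquiv.inner_map_map, inner_oracle] at h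
  exact_mod_cast h

end QueryAlgorithm

/-! ### One exact query versus equidistance -/

theorem IsSymmetric.eq_some {f : PartialBoolFun n} (hf : IsSymmetric f) {x y : Fin n → Bool}
    {b : Bool} (hx : f x = some b) (h : weight x = weight y) : f y = some b := by
  rw [← (hf x y (by simp [hx]) h).2, hx]

theorem IsNonconstant.pos {f : PartialBoolFun n} (hf : IsNonconstant f) : 0 < n := by
  obtain ⟨⟨x, hx⟩, y, hy⟩ := hf
  rcases Nat.eq_zero_or_pos n with rfl | h
  · rw [Subsingleton.elim x y, hy] at hx
    simp at hx
  · exact h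

/-- Averaging the orthogonality relations over the cyclic shifts of the input shows that a
symmetric function computed with one query is equidistant. -/
theorem IsEquidistant.of_computesExactly {f : PartialBoolFun n} (hf : IsSymmetric f)
    (hc : IsNonconstant f) (A : QueryAlgorithm n 1) (hA : A.ComputesExactly f) :
    IsEquidistant f := by
  have hn := hc.pos
  have : NeZero n := ⟨hn.ne'⟩
  set P : ℝ := ∑ i : Fin n, ∑ j, ‖A.U 0 A.start (i.succ, j)‖ ^ 2 with hP
  set P₀ : ℝ := ∑ j, ‖A.U 0 A.start (0, j)‖ ^ 2 with hP₀
  have hP₀_nonneg : 0 ≤ P₀ := Finset.sum_nonneg fun _ _ => sq_nonneg _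
  have hsum : P₀ + P = 1 := by
    rw [hP, hP₀, ← norm_sq_eq_sum, LinearIsometryEquiv.norm_map, A.norm_start, one_pow]
  have key : ∀ x y, f x = some false → f y = some true → (n : ℝ) = 2 * hammingDist x y * P := by
    intro x y hx hy
    have h : ∀ k : Fin n, P₀ + ∑ i : Fin n, (∑ j, ‖A.U 0 A.start (i.succ, j)‖ ^ 2) *
        (if x (i + k) = y (i + k) then 1 else -1) = (0 : ℝ) := fun k =>
      A.sum_eq_zero_of_prob
        (hA _ _ (hf.eq_some hx (weight_comp_perm x (Equiv.addRight k)).symm))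
        (hA _ _ (hf.eq_some hy (weight_comp_perm y (Equiv.addRight k)).symm))
    have h' := Finset.sum_congr (s₁ := Finset.univ) rfl fun k _ => h k
    rw [Finset.sum_add_distrib, sum_shift_eq] at h'
    simp only [Finset.sum_const, Finset.card_univ, Fintype.card_fin, nsmul_eq_mul, mul_zero] at h'
    rw [← hP] at h'
    have : P₀ = 1 - P := by linarith
    rw [this] at h'
    linarith
  obtain ⟨⟨x, hx⟩, y, hy⟩ := hc
  have hn' : (0 : ℝ) < n := by exact_mod_cast hn
  have hxy := key x y hx hy
  have hP_ne : P ≠ 0 := by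
    intro h
    rw [h] at hxy
    linarith
  refine ⟨hammingDist x y, ?_, fun x' y' hx' hy' => ?_⟩
  · have : (n : ℝ) ≤ 2 * hammingDist x y := by
      rw [hxy]
      exact mul_le_of_le_one_right (by positivity) (by linarith)
    exact_mod_cast this
  · have h := key x' y' hx' hy'
    rw [hxy] at h
    have := mul_right_cancel₀ hP_ne h
    have : (hammingDist x y : ℝ) = hammingDist x' y' := by linarith
    exact_mod_cast this.symm

/-- The state with probability `1 / (2 * d)` at each of the `n` query positions and the remaining
probability at the null position. -/
noncomputable def balancedState (n d : ℕ) : QSpace n 1 :=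
  WithLp.toLp 2 fun p => if p.1 = 0 then ((√(1 - n / (2 * d) : ℝ) : ℝ) : ℂ)
    else ((√(1 / (2 * d) : ℝ) : ℝ) : ℂ)

/-- The sum is `(1 - n / (2d)) + (n - 2 dist) / (2d)`; `hn` makes the null probability nonnegative,
so that its square root squares back. -/
theorem inner_oracle_balancedState {d : ℕ} (hd : 0 < d) (hn : n ≤ 2 * d) (x y : Fin n → Bool) :
    ⟪oracle 1 x (balancedState n d), oracle 1 y (balancedState n d)⟫_ℂ =
      ((1 - hammingDist x y / d : ℝ) : ℂ) := by
  have hd' : (0 : ℝ) < d := by exact_mod_cast hd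
  have hn' : (n : ℝ) / (2 * d) ≤ 1 := by
    rw [div_le_one (by positivity)]
    exact_mod_cast hn
  rw [inner_oracle]
  simp only [balancedState, Finset.univ_unique, Finset.sum_singleton, if_true, Fin.succ_ne_zero,
    if_false, Complex.norm_real, Real.norm_eq_abs, sq_abs, ← Finset.mul_sum, sum_sign_eq]
  rw [Real.sq_sqrt (by linarith), Real.sq_sqrt (by positivity)]
  congr 1
  field_simp
  ring

theorem norm_balancedState {d : ℕ} (hd : 0 < d) (hn : n ≤ 2 * d) : ‖balancedState n d‖ = 1 := by
  have h : ‖balancedState n d‖ ^ 2 = 1 := by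
    rw [← norm_oracle fun _ => false, ← inner_self_eq_norm_sq (𝕜 := ℂ),
      inner_oracle_balancedState hd hn]
    simp
  exact (pow_eq_one_iff_of_nonneg (norm_nonneg _) two_ne_zero).1 h

/-- Query the state `φ` and measure whether the result lies in the subspace `K`. -/
noncomputable def projectiveAlgorithm {m : ℕ} (φ : QSpace n m) (hφ : ‖φ‖ = 1) (K : Submodule ℂ (QSpace n m)) :
    QueryAlgorithm n 1 where
  m := m
  start := φ
  norm_start := hφ
  U _ := LinearIsometryEquiv.refl ℂ _
  M b := bif b then ContinuousLinearMap.id ℂ _ - K.starProjection else K.starProjection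
  complete := projective_complete _

theorem prob_projectiveAlgorithm_false {m : ℕ} {φ : QSpace n m} {hφ : ‖φ‖ = 1}
    {K : Submodule ℂ (QSpace n m)} {x : Fin n → Bool} (h : oracle m x φ ∈ K) :
    (projectiveAlgorithm φ hφ K).prob x false = 1 := by
  change ‖K.starProjection (oracle m x φ)‖ ^ 2 = 1
  rw [Submodule.starProjection_eq_self_iff.2 h, norm_oracle, hφ, one_pow]

theorem prob_projectiveAlgorithm_true {m : ℕ} {φ : QSpace n m} {hφ : ‖φ‖ = 1}
    {K : Submodule ℂ (QSpace n m)} {x : Fin n → Bool} (h : oracle m x φ ∈ Kᗮ) :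
    (projectiveAlgorithm φ hφ K).prob x true = 1 := by
  change ‖oracle m x φ - K.starProjection (oracle m x φ)‖ ^ 2 = 1
  rw [(Submodule.starProjection_apply_eq_zero_iff K).2 h, sub_zero, norm_oracle, hφ, one_pow]

theorem IsEquidistant.exists_computesExactly {f : PartialBoolFun n} (hc : IsNonconstant f)
    (h : IsEquidistant f) : ∃ A : QueryAlgorithm n 1, A.ComputesExactly f := by
  obtain ⟨d, hd, h⟩ := h
  have hd₀ : 0 < d := by
    have := hc.pos
    omega
  let φ := balancedState n d
  -- The subspace is spanned by the queried states of the 0-inputs; those of the 1-inputs are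
  -- orthogonal to it because their distance to every 0-input is `d`.
  refine ⟨projectiveAlgorithm φ (norm_balancedState hd₀ hd)
    (Submodule.span ℂ {v | ∃ x, f x = some false ∧ oracle 1 x φ = v}), fun x b hx => ?_⟩
  cases b
  · exact prob_projectiveAlgorithm_false (Submodule.subset_span ⟨x, hx, rfl⟩)
  · refine prob_projectiveAlgorithm_true ((Submodule.mem_orthogonal _ _).2 fun u hu => ?_)
    induction hu using Submodule.span_induction with
    | mem u hu =>
      obtain ⟨z, hz, rfl⟩ := hu
      rw [inner_oracle_balancedState hd₀ hd, h z x hz hx,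
        div_self (by exact_mod_cast hd₀.ne'), sub_self, Complex.ofReal_zero]
    | zero => simp
    | add u v _ _ hu hv => rw [inner_add_left, hu, hv, add_zero]
    | smul a u _ hu => rw [inner_smul_left, hu, mul_zero]

/-- Without queries the final state is the same unit vector for all inputs, and it cannot be
orthogonal to itself. -/
theorem exists_zero_query_iff (f : PartialBoolFun n) :
    (∃ A : QueryAlgorithm n 0, A.ComputesExactly f) ↔ ¬ IsNonconstant f := by
  constructor
  · rintro ⟨A, hA⟩ ⟨⟨x, hx⟩, y, hy⟩
    have h := A.inner_finalState (hA _ _ hx) (hA _ _ hy)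
    have e : ∀ z, A.finalState z = A.U 0 A.start := fun z => rfl
    rw [e, e, LinearIsometryEquiv.inner_map_map, inner_self_eq_norm_sq_to_K, A.norm_start] at h
    simp at h
  · intro h
    obtain ⟨b, hb⟩ : ∃ b, ∀ x c, f x = some c → c = b := by
      by_cases h0 : ∃ x, f x = some false
      · refine ⟨false, fun y c hy => ?_⟩
        cases c
        · rfl
        · exact (h ⟨h0, y, hy⟩).elim
      -- This case includes the nowhere defined function, for which either constant would do.
      · refine ⟨true, fun y c hy => ?_⟩
        cases c
        · exact (h0 ⟨y, hy⟩).elim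
        · rfl
    let φ : QSpace n 1 := EuclideanSpace.single (0, 0) 1
    refine ⟨⟨1, φ, by simp [φ], fun _ => LinearIsometryEquiv.refl ℂ _,
      fun c => if c = b then ContinuousLinearMap.id ℂ _ else 0, ?_⟩, fun x c hx => ?_⟩
    · have e : (ContinuousLinearMap.id ℂ (QSpace n 1)).adjoint = ContinuousLinearMap.id ℂ _ :=
        ContinuousLinearMap.adjoint_one
      cases b <;> simp [e]
    · rw [hb x c hx, QueryAlgorithm.prob]
      change ‖(if b = b then ContinuousLinearMap.id ℂ _ else 0 : QSpace n 1 →L[ℂ] QSpace n 1) φ‖ ^ 2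
        = 1
      simp [φ]

theorem QE_eq_one_iff_exists (f : PartialBoolFun n) :
    QE f = 1 ↔ IsNonconstant f ∧ ∃ A : QueryAlgorithm n 1, A.ComputesExactly f := by
  rw [← not_iff_comm.1 (exists_zero_query_iff f).symm]
  constructor
  · intro h
    refine ⟨fun h0 => ?_, ?_⟩
    · have : QE f ≤ 0 := Nat.sInf_le h0
      omega
    -- In `ℕ` the infimum of the empty set is `0`, so the value `1` is attained by an actual
    -- algorithm.
    · have := Nat.sInf_mem (Nat.nonempty_of_sInf_eq_succ (s :=
        {t | ∃ A : QueryAlgorithm n t, A.ComputesExactly f}) h)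
      change QE f ∈ _ at this
      rwa [h] at this
  · rintro ⟨h0, h1⟩
    have hle : QE f ≤ 1 := Nat.sInf_le h1
    have hmem : QE f ∈ {t | ∃ A : QueryAlgorithm n t, A.ComputesExactly f} := Nat.sInf_mem ⟨1, h1⟩
    have : QE f ≠ 0 := fun h => h0 (by rwa [h] at hmem)
    omega

theorem QE_eq_one_iff {f : PartialBoolFun n} (hf : IsSymmetric f) :
    QE f = 1 ↔ IsNonconstant f ∧ IsEquidistant f := by
  rw [QE_eq_one_iff_exists]
  exact ⟨fun ⟨hc, A, hA⟩ => ⟨hc, .of_computesExactly hf hc A hA⟩,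
    fun ⟨hc, h⟩ => ⟨hc, h.exists_computesExactly hc⟩⟩

/-! ### The Deutsch–Jozsa algorithm -/

theorem inner_oracle_uniformState {N : ℕ} (hN : 0 < N) (x y : Fin N → Bool) :
    ⟪oracle 1 x (uniformState N), oracle 1 y (uniformState N)⟫_ℂ =
      ((1 - 2 * hammingDist x y / N : ℝ) : ℂ) := by
  have hN' : (0 : ℝ) < N := by exact_mod_cast hN
  rw [inner_oracle]
  simp only [uniformState, Finset.univ_unique, Finset.sum_singleton, if_true, Fin.succ_ne_zero,
    if_false, Complex.norm_real, Real.norm_eq_abs, sq_abs, ← Finset.mul_sum, sum_sign_eq, div_pow,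
    Real.sq_sqrt hN'.le, norm_zero]
  congr 1
  field_simp
  ring

theorem oracle_false {m : ℕ} (φ : QSpace n m) : oracle m (fun _ => false) φ = φ := by
  ext ⟨i, j⟩
  cases i using Fin.cases <;> simp [oracle_apply, phase]

theorem oracle_true_uniformState (N : ℕ) :
    oracle 1 (fun _ => true) (uniformState N) = -uniformState N := by
  ext ⟨i, j⟩
  cases i using Fin.cases <;> simp [oracle_apply, phase, uniformState]

theorem prob_deutschJozsa_false {N : ℕ} (hN : 0 < N) {x : Fin N → Bool}
    (h : weight x = 0 ∨ weight x = N) : (deutschJozsa N hN).prob x false = 1 := by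
  refine prob_projectiveAlgorithm_false (hφ := norm_uniformState hN) ?_
  rcases h with h | h
  · rw [weight_eq_zero_iff.1 h, oracle_false]
    exact Submodule.mem_span_singleton_self _
  · rw [weight_eq_iff.1 h, oracle_true_uniformState]
    exact neg_mem (Submodule.mem_span_singleton_self _)

theorem prob_deutschJozsa_true {N : ℕ} (hN : 0 < N) {x : Fin N → Bool}
    (h : 2 * weight x = N) : (deutschJozsa N hN).prob x true = 1 := by
  refine prob_projectiveAlgorithm_true (hφ := norm_uniformState hN) ?_
  rw [Submodule.mem_orthogonal_singleton_iff_inner_right]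
  have h1 := inner_oracle_uniformState hN (fun _ => false) x
  rw [oracle_false, ← weight_eq_hammingDist] at h1
  have h2 : (2 * weight x : ℝ) = N := by exact_mod_cast h
  rw [h1, h2, div_self (by exact_mod_cast hN.ne'), sub_self, Complex.ofReal_zero]

/-- Orthogonality of the final states gives `1 - 2 dist / N = 0`, so the common distance is half the
padded length. -/
theorem DJComputesPadded.isEquidistant {p : ℕ} {g : PartialBoolFun n} {w : Fin p → Bool}
    (h : DJComputesPadded g w) : IsEquidistant g := by
  obtain ⟨⟨d, hd⟩, hN, h⟩ := h
  refine ⟨d, by omega, fun x y hx hy => ?_⟩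
  have h0 := (deutschJozsa (n + p) hN).inner_finalState (h x _ hx) (h y _ hy)
  change ⟪oracle 1 _ (uniformState (n + p)), oracle 1 _ (uniformState (n + p))⟫_ℂ = 0 at h0
  rw [inner_oracle_uniformState hN, hammingDist_append_right, Complex.ofReal_eq_zero] at h0
  have hN' : ((n + p : ℕ) : ℝ) ≠ 0 := by exact_mod_cast hN.ne'
  field_simp at h0
  have h1 : ((n + p : ℕ) : ℝ) = 2 * hammingDist x y := by linarith
  have h2 : n + p = 2 * hammingDist x y := by exact_mod_cast h1
  omega

theorem SolvableByDJZeros.solvableByDJ {f : PartialBoolFun n} (h : SolvableByDJZeros f) :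
    SolvableByDJ f := by
  obtain ⟨g, hg, p, hp⟩ := h
  exact ⟨g, hg, p, _, hp⟩

theorem SolvableByDJ.isEquidistant {f : PartialBoolFun n} (h : SolvableByDJ f) :
    IsEquidistant f := by
  obtain ⟨g, hg, p, w, hp⟩ := h
  exact hg.symm.isEquidistant hp.isEquidistant

/-- With `2k - n` zeros (no truncation, by `hk`) the length is `2k`: weight `k` becomes balanced and
weight `0` stays zero. -/
theorem djComputesPadded_f₁ {k : ℕ} (hk₀ : 0 < k) (hk : n ≤ 2 * k) :
    DJComputesPadded (f₁ n k) (fun _ : Fin (2 * k - n) => false) := by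
  have hN : n + (2 * k - n) = 2 * k := by omega
  refine ⟨by simp [hN], by omega, fun x b hx => ?_⟩
  unfold f₁ at hx
  split_ifs at hx with h1 h2 <;> simp at hx <;> subst hx
  · exact prob_deutschJozsa_false _ (Or.inl (by rw [weight_append_false, h1]))
  · exact prob_deutschJozsa_true _ (by rw [weight_append_false]; omega)

theorem djComputesPadded_f₃ (hn₀ : 0 < n) (hn : Even n) :
    DJComputesPadded (f₃ n (n / 2)) (fun _ : Fin 0 => false) := by
  refine ⟨by simpa using hn, by omega, fun x b hx => ?_⟩
  have hn' := Nat.two_mul_div_two_of_even hn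
  unfold f₃ at hx
  split_ifs at hx with h1 h2 <;> simp at hx <;> subst hx
  · exact prob_deutschJozsa_false _ (by rwa [weight_append_false])
  · exact prob_deutschJozsa_true _ (by rw [weight_append_false]; omega)

theorem isNonconstant_f₁ {k : ℕ} (hk₀ : 0 < k) (hk : k ≤ n) : IsNonconstant (f₁ n k) := by
  obtain ⟨x, hx⟩ := exists_weight_eq (Nat.zero_le n)
  obtain ⟨y, hy⟩ := exists_weight_eq hk
  exact ⟨⟨x, by simp [f₁, hx]⟩, y, by simp [f₁, hy, hk₀.ne']⟩

theorem isNonconstant_f₃ {l : ℕ} (hl₀ : 0 < l) (hl : l < n) : IsNonconstant (f₃ n l) := by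
  obtain ⟨x, hx⟩ := exists_weight_eq (Nat.zero_le n)
  obtain ⟨y, hy⟩ := exists_weight_eq hl.le
  exact ⟨⟨x, by simp [f₃, hx]⟩, y, by simp [f₃, hy, hl₀.ne', hl.ne]⟩

/-! ### Classification of the symmetric equidistant functions -/

/-- Otherwise some rearrangement `z` of `y` agrees with `x` at a position holding 1 and at one
holding 0. Swapping these two entries of `z` creates two new disagreements at unchanged weight. -/
theorem IsEquidistant.eq_const_or_eq_const {f : PartialBoolFun n} (hf : IsSymmetric f)
    (h : IsEquidistant f) {x y : Fin n → Bool} (hx : f x = some false) (hy : f y = some true) :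
    (∃ b, x = fun _ => b) ∨ ∃ b, y = fun _ => b := by
  obtain ⟨d, -, h⟩ := h
  have nonconst : ∀ z : Fin n → Bool, (¬ ∃ b, z = fun _ => b) →
      ∃ i j, z i = true ∧ z j = false := by
    intro z hz
    push Not at hz
    obtain ⟨i, hi⟩ := Function.ne_iff.1 (hz false)
    obtain ⟨j, hj⟩ := Function.ne_iff.1 (hz true)
    exact ⟨i, j, by simpa using hi, by simpa using hj⟩
  by_contra! hcon
  obtain ⟨i, j, hi, hj⟩ := nonconst x (by simpa using hcon.1)
  obtain ⟨i', j', hi', hj'⟩ := nonconst y (by simpa using hcon.2)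
  have hij : i ≠ j := fun e => by simp [e, hj] at hi
  have hij' : i' ≠ j' := fun e => by simp [e, hj'] at hi'
  obtain ⟨σ, hσi, hσj⟩ : ∃ σ : Equiv.Perm (Fin n), σ i = i' ∧ σ j = j' := by
    -- The second swap corrects the image of `j`; it fixes `i'` because `i ≠ j` and `i' ≠ j'`.
    refine ⟨(Equiv.swap i i').trans (Equiv.swap (Equiv.swap i i' j) j'), ?_, by simp⟩
    rw [Equiv.trans_apply, Equiv.swap_apply_left, Equiv.swap_apply_of_ne_of_ne _ hij']
    exact fun e => hij ((Equiv.swap i i').injective ((Equiv.swap_apply_left i i').trans e))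
  let z := fun k => y (σ k)
  let w := fun k => z (Equiv.swap i j k)
  have hz : f z = some true := hf.eq_some hy (weight_comp_perm y σ).symm
  have hw : f w = some true := hf.eq_some hz (weight_comp_perm z _).symm
  have hzi : z i = true := by simp [z, hσi, hi']
  have hzj : z j = false := by simp [z, hσj, hj']
  have hlt : hammingDist x z < hammingDist x w := by
    refine Finset.card_lt_card (Finset.ssubset_iff_of_subset ?_ |>.2 ⟨i, ?_, ?_⟩)
    · intro k hk
      have hk' : x k ≠ z k := by simpa using hk
      have hki : k ≠ i := fun e => by simp [e, hi, hzi] at hk'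
      have hkj : k ≠ j := fun e => by simp [e, hj, hzj] at hk'
      simpa [w, Equiv.swap_apply_of_ne_of_ne hki hkj] using hk'
    · simp [w, hi, hzj]
    · simp [hi, hzi]
  rw [h x z hx hz, h x w hx hw] at hlt
  exact lt_irrefl _ hlt

/-- Distance to the zero string is weight, so the 1-inputs are exactly those of weight `d`. Only the
value at the all-ones string remains open, and it decides between the two forms. -/
theorem eq_f₁_or_eq_f₃ {f : PartialBoolFun n} (hf : IsSymmetric f) (hc : IsNonconstant f)
    (h : IsEquidistant f) (h0 : f (fun _ => false) = some false)
    (hconst : ∀ x, f x = some false → ∃ b, x = fun _ => b) :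
    (∃ k, 0 < k ∧ n ≤ 2 * k ∧ k ≤ n ∧ f = f₁ n k) ∨ (Even n ∧ f = f₃ n (n / 2)) := by
  obtain ⟨d, hd, h⟩ := h
  have hn := hc.pos
  obtain ⟨-, y, hy⟩ := hc
  have hyd : weight y = d := by rw [weight_eq_hammingDist]; exact h _ _ h0 hy
  have htrue : ∀ x, f x = some true ↔ weight x = d := fun x =>
    ⟨fun hx => by rw [weight_eq_hammingDist]; exact h _ _ h0 hx,
      fun hx => hf.eq_some hy (by rw [hx, hyd])⟩
  have hdn : d ≤ n := hyd ▸ weight_le y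
  have hext : ∀ (g : PartialBoolFun n), (∀ x, f x = some true ↔ g x = some true) →
      (∀ x, f x = some false ↔ g x = some false) → f = g := by
    intro g hg1 hg0
    funext x
    refine Option.ext fun b => ?_
    cases b
    · exact hg0 x
    · exact hg1 x
  have hfalse : ∀ x, f x = some false ↔ weight x = 0 ∨
      (weight x = n ∧ f (fun _ => true) = some false) := by
    intro x
    constructor
    · intro hx
      obtain ⟨b, rfl⟩ := hconst x hx
      cases b
      · exact Or.inl (weight_eq_zero_iff.2 rfl)
      · exact Or.inr ⟨weight_eq_iff.2 rfl, hx⟩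
    · rintro (hx | ⟨hx, hx'⟩)
      · rwa [weight_eq_zero_iff.1 hx]
      · rwa [weight_eq_iff.1 hx]
  by_cases h1 : f (fun _ => true) = some false
  · right
    -- The all-ones string is also at distance `d` from `y`, so `d + d = n`.
    have hdist : hammingDist (fun _ => true) y + weight y = n := by
      refine Eq.trans ?_ (weight_not y)
      simp [hammingDist, weight]
    rw [h _ _ h1 hy, hyd] at hdist
    have hdd : n / 2 = d := by omega
    refine ⟨⟨d, hdist.symm⟩, hext _ (fun x => ?_) fun x => ?_⟩
    · rw [htrue, f₃, hdd]
      split_ifs <;> simp <;> omega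
    · rw [hfalse, f₃, hdd]
      split_ifs <;> simp [h1] <;> omega
  · left
    refine ⟨d, by omega, hd, hdn, hext _ (fun x => ?_) fun x => ?_⟩
    · rw [htrue, f₁]
      split_ifs <;> simp <;> omega
    · rw [hfalse, f₁]
      split_ifs <;> simp [h1] <;> omega

/-- The isomorphic function obtained by negating all inputs if `s`, and the output if `c`. -/
def flip (f : PartialBoolFun n) (s c : Bool) : PartialBoolFun n :=
  fun x => (f fun i => xor (x i) s).map (xor c)

theorem isomorphic_flip (f : PartialBoolFun n) (s c : Bool) : Isomorphic f (flip f s c) :=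
  ⟨1, fun _ => s, c, fun _ => rfl⟩

theorem flip_eq_some_iff {f : PartialBoolFun n} {s c b : Bool} {x : Fin n → Bool} :
    flip f s c x = some b ↔ f (fun i => xor (x i) s) = some (xor c b) := by
  rw [flip, Option.map_eq_some_iff]
  constructor
  · rintro ⟨a, ha, rfl⟩
    simpa using ha
  · intro h
    exact ⟨_, h, by simp⟩

theorem IsSymmetric.flip {f : PartialBoolFun n} (hf : IsSymmetric f) (s c : Bool) :
    IsSymmetric (flip f s c) := by
  intro x y hx hxy
  obtain ⟨b, hb⟩ := Option.ne_none_iff_exists'.1 hx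
  have hw : weight (fun i => xor (x i) s) = weight (fun i => xor (y i) s) := by
    have h1 := weight_not x
    have h2 := weight_not y
    cases s
    · simpa using hxy
    · simp only [Bool.xor_true]
      omega
  have hb' := flip_eq_some_iff.2 (hf.eq_some (flip_eq_some_iff.1 hb) hw)
  exact ⟨by simp [hb'], by rw [hb, hb']⟩

theorem IsEquidistant.isomorphic_f₁_or_f₃ {f : PartialBoolFun n} (hf : IsSymmetric f)
    (hc : IsNonconstant f) (h : IsEquidistant f) :
    (∃ k, 0 < k ∧ n ≤ 2 * k ∧ k ≤ n ∧ Isomorphic f (f₁ n k)) ∨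
      (Even n ∧ Isomorphic f (f₃ n (n / 2))) := by
  -- `c` is a value taken only on constant strings; negating inputs by `s` and output by `c` moves
  -- it to value 0 at the zero string.
  obtain ⟨c, hconst⟩ : ∃ c, ∀ x, f x = some c → ∃ b, x = fun _ => b := by
    by_contra! hcon
    obtain ⟨x, hx, hx'⟩ := hcon false
    obtain ⟨y, hy, hy'⟩ := hcon true
    rcases h.eq_const_or_eq_const hf hx hy with ⟨b, hb⟩ | ⟨b, hb⟩
    · exact hx' b hb
    · exact hy' b hb
  obtain ⟨x, hx⟩ : ∃ x, f x = some c := by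
    cases c
    · exact hc.1
    · exact hc.2
  obtain ⟨s, rfl⟩ := hconst x hx
  have hiso := isomorphic_flip f s c
  have hconst' : ∀ z, flip f s c z = some false → ∃ b, z = fun _ => b := by
    intro z hz
    obtain ⟨b, hb⟩ := hconst _ (by simpa using flip_eq_some_iff.1 hz)
    refine ⟨xor b s, funext fun i => ?_⟩
    have := congrFun hb i
    rw [← this]
    simp
  rcases eq_f₁_or_eq_f₃ (hf.flip s c) (hiso.isNonconstant hc) (hiso.isEquidistant h)
    (flip_eq_some_iff.2 (by simpa using hx)) hconst' with ⟨k, h0, h1, h2, e⟩ | ⟨h0, e⟩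
  · exact Or.inl ⟨k, h0, h1, h2, e ▸ hiso⟩
  · exact Or.inr ⟨h0, e ▸ hiso⟩

theorem isEquidistant_iff_solvableByDJZeros {f : PartialBoolFun n} (hf : IsSymmetric f)
    (hc : IsNonconstant f) : IsEquidistant f ↔ SolvableByDJZeros f := by
  refine ⟨fun h => ?_, fun h => h.solvableByDJ.isEquidistant⟩
  rcases h.isomorphic_f₁_or_f₃ hf hc with ⟨k, h0, h1, -, e⟩ | ⟨h0, e⟩
  · exact ⟨_, e, _, djComputesPadded_f₁ h0 h1⟩
  · exact ⟨_, e, _, djComputesPadded_f₃ hc.pos h0⟩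

/-- Equidistance of `f₁ n k` is read off from its Deutsch–Jozsa algorithm. -/
theorem QE_eq_one_of_isomorphic_f₁ {f : PartialBoolFun n} (hf : IsSymmetric f) {k : ℕ}
    (hk₀ : 0 < k) (hk : n ≤ 2 * k) (hkn : k ≤ n) (h : Isomorphic f (f₁ n k)) : QE f = 1 :=
  (QE_eq_one_iff hf).2 ⟨h.symm.isNonconstant (isNonconstant_f₁ hk₀ hkn),
    h.symm.isEquidistant (djComputesPadded_f₁ hk₀ hk).isEquidistant⟩

theorem QE_eq_one_of_isomorphic_f₃ {f : PartialBoolFun n} (hf : IsSymmetric f)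
    (hn₀ : 0 < n) (hn : Even n) (h : Isomorphic f (f₃ n (n / 2))) : QE f = 1 :=
  (QE_eq_one_iff hf).2
    ⟨h.symm.isNonconstant (isNonconstant_f₃
      (by have := Nat.two_mul_div_two_of_even hn; omega) (by omega)),
    h.symm.isEquidistant (djComputesPadded_f₃ hn₀ hn).isEquidistant⟩

end QuantumQuery

theorem mainTheorem2 {n : ℕ} (f : QuantumQuery.PartialBoolFun n)
    (hf : QuantumQuery.IsSymmetric f) :
    (Even n → 0 < n →
      (QuantumQuery.QE f = 1 ↔
        (∃ k, n / 2 ≤ k ∧ k ≤ n ∧ QuantumQuery.Isomorphic f (QuantumQuery.f₁ n k)) ∨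
          QuantumQuery.Isomorphic f (QuantumQuery.f₃ n (n / 2)))) ∧
    (Odd n →
      (QuantumQuery.QE f = 1 ↔
        ∃ k, (n + 1) / 2 ≤ k ∧ k ≤ n ∧ QuantumQuery.Isomorphic f (QuantumQuery.f₁ n k))) ∧
    (QuantumQuery.QE f = 1 ↔ QuantumQuery.IsNonconstant f ∧ QuantumQuery.SolvableByDJ f) ∧
    (QuantumQuery.QE f = 1 ↔
      QuantumQuery.IsNonconstant f ∧ QuantumQuery.SolvableByDJZeros f) := by
  open QuantumQuery in
  refine ⟨fun hn hn₀ => ⟨fun h => ?_, ?_⟩, fun hn => ⟨fun h => ?_, ?_⟩, ?_, ?_⟩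
  · obtain ⟨hc, h⟩ := (QE_eq_one_iff hf).1 h
    rcases h.isomorphic_f₁_or_f₃ hf hc with ⟨k, -, h1, h2, e⟩ | ⟨-, e⟩
    · exact Or.inl ⟨k, by omega, h2, e⟩
    · exact Or.inr e
  · have := Nat.two_mul_div_two_of_even hn
    rintro (⟨k, h1, h2, e⟩ | e)
    · exact QE_eq_one_of_isomorphic_f₁ hf (by omega) (by omega) h2 e
    · exact QE_eq_one_of_isomorphic_f₃ hf hn₀ hn e
  · obtain ⟨hc, h⟩ := (QE_eq_one_iff hf).1 h
    rcases h.isomorphic_f₁_or_f₃ hf hc with ⟨k, -, h1, h2, e⟩ | ⟨he, -⟩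
    · exact ⟨k, by omega, h2, e⟩
    · exact (Nat.not_even_iff_odd.2 hn he).elim
  · rintro ⟨k, h1, h2, e⟩
    -- Positivity of `n` excludes `k = 0`.
    have := hn.pos
    exact QE_eq_one_of_isomorphic_f₁ hf (by omega) (by omega) h2 e
  · rw [QE_eq_one_iff hf]
    exact and_congr_right fun hc =>
      ⟨fun h => ((isEquidistant_iff_solvableByDJZeros hf hc).1 h).solvableByDJ,
        fun h => h.isEquidistant⟩
  · rw [QE_eq_one_iff hf]
    exact and_congr_right fun hc => isEquidistant_iff_solvableByDJZeros hf hc
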